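/- Let $(s_n)_{n\ge 0} = 1, 1, 3, 11, 45, 197, \dots$ be the little Schröder numbers. All trees are ordered (plane) rooted trees; a \emph{generator} of a tree is a vertex that is a leaf (outdegree $0$) or has outdegree $1$, and the one-vertex tree has exactly one leaf. For $j\ge 1$ let $\mathcal{ST}_{j-1}$ be the set of ordered rooted trees with $j$ leaves and no vertex of outdegree $1$. \textbf{Theorem.} For every $j\ge 1$, $\#\mathcal{ST}_{j-1}=s_{j-1}$. For every $n\ge 1$, the set $\mathcal{T}_n$ of ordered rooted trees with $n$ generators is in one-to-one correspondence with the set of Dyck paths of semilength $n$ in which each ascent (maximal run of up-steps) of length $j$ is colored in one of $s_{j-1}$ colors. More precisely, taking as colors of a $j$-ascent the elements of $\mathcal{ST}_{j-1}$, the following map $\psi$ is a bijection from the set of colored Dyck paths of semilength $n$ onto $\mathcal{T}_n$. Let $P$ be a colored Dyck path with ascents colored $G_1,\dots,G_k$, and with descents (maximal runs of down-steps) of lengths $j_1,\dots,j_k$, both listed from left to right. Start at the root of $G_1$ and traverse the tree in depth-first, left-to-right order until its $j_1$-th leaf is reached; add an edge from that leaf to the root of $G_2$, so that the root of $G_2$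 is its only child. From that node, which is no longer a leaf, continue the traversal of the augmented tree until the $j_2$-th leaf after it is reached, attach $G_3$ there in the same way, and so on until $G_k$ has been attached (the last descent $j_k$ is not used). The resulting tree is $\psi(P)$. -/

import Mathlib

/-- Ordered (plane) rooted trees: a root together with the list, from left to right, of the
subtrees hanging from its children. -/
inductive OrderedTree : Type
  | node : List OrderedTree → OrderedTree

namespace OrderedTree

/-- The outdegree (number of children) of the root. -/
def outdegree : OrderedTree → ℕ
  | node ts => ts.length

/-- The list of all vertices of a tree in depth-first order, each vertex being represented by the
subtree rooted at it (so one entry for every vertex, with repetitions). -/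
def vertices : OrderedTree → List OrderedTree
  | node ts => node ts :: go ts
where
  go : List OrderedTree → List OrderedTree
    | [] => []
    | t :: ts => t.vertices ++ go ts

/-- The number of leaves, i.e. of vertices of outdegree 0. A one-vertex tree has one leaf. -/
def leaves (t : OrderedTree) : ℕ := t.vertices.countP (fun v => v.outdegree = 0)

/-- The number of generators, i.e. of vertices that are leaves or have outdegree 1. -/
def generators (t : OrderedTree) : ℕ :=
  t.vertices.countP (fun v => v.outdegree = 0 ∨ v.outdegree = 1)

/-- No vertex of the tree has outdegree 1. -/
def NoUnary (t : OrderedTree) : Prop := ∀ v ∈ t.vertices, v.outdegree ≠ 1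

/-- `graft g t i` adds an edge between the leaf of `t` that is preceded by exactly `i` leaves in
the depth-first (left to right) order and the root of `g`, so that this leaf becomes a vertex
whose only child is the root of `g`. If there is no such leaf, `t` is unchanged. -/
def graft (g : OrderedTree) : OrderedTree → ℕ → OrderedTree
  | node [], 0 => node [g]
  | node [], _ + 1 => node []
  | node (t :: ts), i => node (go (t :: ts) i)
where
  go : List OrderedTree → ℕ → List OrderedTree
    | [], _ => []
    | t :: ts, i => if i < t.leaves then graft g t i :: ts else t :: go ts (i - t.leaves)

end OrderedTree

/-- The ordered trees with `j` leaves and no vertex of outdegree 1. -/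
def SchroderTree (j : ℕ) : Type := {t : OrderedTree // t.leaves = j ∧ t.NoUnary}

/-- The little Schröder numbers 1, 1, 3, 11, 45, 197, ..., indexed from 0. (`Nat.smallSchroder`
is the same sequence with an additional initial term 1.) -/
def littleSchroder (n : ℕ) : ℕ := Nat.smallSchroder (n + 1)

namespace DyckWord

/-- The lengths, from left to right, of the maximal runs of the step `s` in a Dyck path. -/
def runLengths (s : DyckStep) (p : DyckWord) : List ℕ :=
  ((p.toList.splitBy (fun a b => a == b)).filter (fun r => s ∈ r)).map List.length

/-- The lengths of the ascents (maximal runs of up-steps). -/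
def ascents (p : DyckWord) : List ℕ := p.runLengths DyckStep.U

/-- The lengths of the descents (maximal runs of down-steps). In a Dyck path the `i`-th descent
immediately follows the `i`-th ascent. -/
def descents (p : DyckWord) : List ℕ := p.runLengths DyckStep.D

end DyckWord

/-- Dyck paths of semilength `n` in which every ascent carries a colour, the colours available to
an ascent of length `j` being the elements of `C j`. -/
structure ColoredDyckPath (C : ℕ → Type) (n : ℕ) where
  path : DyckWord
  semilength_eq : path.semilength = n
  color : (i : Fin path.ascents.length) → C (path.ascents.get i)

namespace ColoredDyckPath

/-- One step of the insertion algorithm. The state consists of the tree `s.1` built so far and the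
number `s.2` of its leaves that precede the current position of the traversal; when the next
descent has length `d.1`, the traversal moves on to the `d.1`-th leaf from that position, and the
tree `d.2` is attached below that leaf, which becomes the new position. -/
def insertStep (s : OrderedTree × ℕ) (d : ℕ × OrderedTree) : OrderedTree × ℕ :=
  (OrderedTree.graft d.2 s.1 (s.2 + (d.1 - 1)), s.2 + (d.1 - 1))

/-- The insertion algorithm for trees `G₁, G₂, …, Gₖ` and descents `j₁, j₂, …`: start at the root of
`G₁`, and successively insert `Gᵢ₊₁` at the `jᵢ`-th leaf from the current position.
The value for the empty list of trees is immaterial. -/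
def insertAll (js : List ℕ) : List OrderedTree → OrderedTree
  | [] => .node []
  | G :: Gs => ((js.zip Gs).foldl insertStep (G, 0)).1

/-- The ordered tree built by the insertion algorithm from a Dyck path each of whose ascents of
length `j` is coloured by an ordered tree with `j` leaves and no vertex of outdegree 1. -/
def toTree {n : ℕ} (P : ColoredDyckPath SchroderTree n) : OrderedTree :=
  insertAll P.path.descents (List.ofFn fun i => (P.color i).1)

end ColoredDyckPath

/-!
Read a tree as its Łukasiewicz word, the list of the outdegrees of its vertices in depth-first
order. Attaching a tree below a leaf replaces a letter 0 of the word by a letter 1 followed by the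
word of the attached tree, which has no letter 1. The last letter 1 of the final word therefore
marks the last attachment, so that the algorithm can be undone. After each attachment, the height of
the path after the corresponding ascent is the number of leaves still ahead of the traversal: the
path stays above the axis exactly when every required leaf exists.

For the number of colours, consider forests instead of trees. A nonempty forest whose first tree is
not a single vertex splits into two nonempty forests: the first child of the first root followed by
the other trees of the forest, and the remaining children of that root. This is the recursion of the
large Schröder numbers. A forest with at least two leaves is either one tree or the list of the
children of the root of one, so there are twice as many forests as trees.
-/

theorem splitBy_replicate_append {α : Type*} [BEq α] [LawfulBEq α] {a : α} {k : ℕ} {w : List α}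
    (hk : k ≠ 0) (hw : ∀ b ∈ w.head?, a ≠ b) :
    (List.replicate k a ++ w).splitBy (· == ·) = List.replicate k a :: w.splitBy (· == ·) := by
  rw [List.splitBy_append (by simpa [List.getLast?_replicate, hk] using hw),
    List.splitBy_of_isChain (by simpa using hk) (List.isChain_replicate_of_rel k (by simp)),
    List.singleton_append]

theorem append_cons_inj_of_notMem_right {α : Type*} {a : α} {x₁ x₂ y₁ y₂ : List α}
    (h₁ : a ∉ y₁) (h₂ : a ∉ y₂) (h : x₁ ++ a :: y₁ = x₂ ++ a :: y₂) : x₁ = x₂ ∧ y₁ = y₂ := by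
  obtain ⟨z, hx, hy⟩ | ⟨z, hx, hy⟩ := List.append_eq_append_iff.1 h <;>
    obtain _ | ⟨b, z⟩ := z <;> simp_all

theorem exists_eq_append_cons_notMem_right {α : Type*} {a : α} {w : List α} (h : a ∈ w) :
    ∃ x y, w = x ++ a :: y ∧ a ∉ y := by
  obtain ⟨x, y, hw, hx⟩ := List.eq_append_cons_of_mem (List.mem_reverse.2 h)
  exact ⟨y.reverse, x.reverse, by simpa using congrArg List.reverse hw, by simpa using hx⟩

theorem exists_eq_append_cons_of_lt_count {α : Type*} [DecidableEq α] {a : α} :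
    ∀ {w : List α} {k : ℕ}, k < w.count a → ∃ x y, w = x ++ a :: y ∧ x.count a = k
  | b :: w, k, hk => by
    by_cases hb : b = a
    · subst hb
      obtain _ | k := k
      · exact ⟨[], w, by simp⟩
      · obtain ⟨x, y, rfl, rfl⟩ := exists_eq_append_cons_of_lt_count (w := w) (k := k)
          (by simpa using hk)
        exact ⟨b :: x, y, by simp⟩
    · obtain ⟨x, y, rfl, rfl⟩ := exists_eq_append_cons_of_lt_count (w := w) (k := k)
        (by simpa [hb] using hk)
      exact ⟨b :: x, y, by simp, by simp [hb]⟩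

theorem append_eq_append_cons_cases {α : Type*} {a : α} {v w x y : List α}
    (h : v ++ w = x ++ a :: y) :
    (∃ z, v = x ++ a :: z ∧ y = z ++ w) ∨ ∃ z, x = v ++ z ∧ w = z ++ a :: y := by
  obtain ⟨z, hx, hy⟩ | ⟨z, hv, hw⟩ := List.append_eq_append_iff.1 h
  · exact .inr ⟨z, hx, hy⟩
  · obtain _ | ⟨b, z⟩ := z
    · exact .inr ⟨[], by simpa using hv.symm, hw.symm⟩
    · obtain ⟨rfl, rfl⟩ := List.cons.inj hw
      exact .inl ⟨z, hv, rfl⟩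

namespace OrderedTree

/-- The Łukasiewicz word of a tree: the outdegrees of its vertices in depth-first order. -/
def word (t : OrderedTree) : List ℕ := t.vertices.map outdegree

/-- The Łukasiewicz word of an ordered forest, the concatenation of the words of its trees. -/
def forestWord (ts : List OrderedTree) : List ℕ := ts.flatMap word

@[simp] theorem forestWord_nil : forestWord [] = [] := rfl

@[simp] theorem forestWord_cons (t : OrderedTree) (ts : List OrderedTree) :
    forestWord (t :: ts) = t.word ++ forestWord ts := rfl

theorem map_outdegree_vertices_go (ts : List OrderedTree) :
    (vertices.go ts).map outdegree = forestWord ts := by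
  induction ts with
  | nil => rfl
  | cons t ts ih => simp [vertices.go, ih, word]

@[simp] theorem word_node (ts : List OrderedTree) :
    (node ts).word = ts.length :: forestWord ts := by
  simp [word, vertices, map_outdegree_vertices_go, outdegree]

theorem forestWord_eq_nil_iff {ts : List OrderedTree} : forestWord ts = [] ↔ ts = [] := by
  obtain _ | ⟨⟨cs⟩, ss⟩ := ts <;> simp

theorem forestWord_eq_cons_iff {k : ℕ} {w : List ℕ} {ts : List OrderedTree} :
    forestWord ts = k :: w ↔
      ∃ cs ss, ts = node cs :: ss ∧ cs.length = k ∧ forestWord (cs ++ ss) = w := by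
  obtain _ | ⟨⟨cs⟩, ss⟩ := ts <;> simp [forestWord]

theorem forestWord_injective : Function.Injective forestWord := by
  intro ts ts' h
  induction hw : forestWord ts generalizing ts ts' with
  | nil =>
    rw [forestWord_eq_nil_iff.1 hw, forestWord_eq_nil_iff.1 (h.symm.trans hw)]
  | cons k w ih =>
    obtain ⟨cs, ss, rfl, hk, hcs⟩ := forestWord_eq_cons_iff.1 hw
    obtain ⟨cs', ss', rfl, hk', hcs'⟩ := forestWord_eq_cons_iff.1 (h.symm.trans hw)
    obtain ⟨rfl, rfl⟩ := List.append_inj (ih (hcs.trans hcs'.symm) hcs) (hk.trans hk'.symm)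
    rfl

theorem word_injective : Function.Injective word := fun t t' h => by
  simpa using forestWord_injective (a₁ := [t]) (a₂ := [t']) (by simp [h])

theorem exists_forestWord_eq_of_append {u v : List ℕ} :
    ∀ {ts : List OrderedTree}, forestWord ts = u ++ v → ∃ vs, forestWord vs = v := by
  induction u with
  | nil => exact fun {ts} h => ⟨ts, h⟩
  | cons k u ih =>
    intro ts h
    obtain ⟨cs, ss, -, -, hcs⟩ := forestWord_eq_cons_iff.1 h
    exact ih hcs

theorem exists_forestWord_eq_append_of_length_eq {u : List ℕ} {vs vs' : List OrderedTree}
    (hlen : vs'.length = vs.length) :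
    ∀ {ts : List OrderedTree}, forestWord ts = u ++ forestWord vs →
      ∃ ts', ts'.length = ts.length ∧ forestWord ts' = u ++ forestWord vs' := by
  induction u with
  | nil =>
    intro ts h
    obtain rfl := forestWord_injective h
    exact ⟨vs', hlen, rfl⟩
  | cons k u ih =>
    intro ts h
    obtain ⟨cs, ss, rfl, rfl, hcs⟩ := forestWord_eq_cons_iff.1 h
    obtain ⟨ts', hlen', hts'⟩ := ih hcs
    refine ⟨node (ts'.take cs.length) :: ts'.drop cs.length, by simp [hlen'], ?_⟩
    exact forestWord_eq_cons_iff.2 ⟨_, _, rfl, by simp [hlen'], by simp [hts']⟩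

theorem exists_word_eq_append_last_unary {t : OrderedTree} (h : 1 ∈ t.word) :
    ∃ u g ys, t.word = u ++ 1 :: forestWord (g :: ys) ∧ 1 ∉ g.word ∧ 1 ∉ forestWord ys := by
  obtain ⟨u, r, ht, hr⟩ := exists_eq_append_cons_notMem_right h
  obtain ⟨vs, hvs⟩ := exists_forestWord_eq_of_append (ts := [t]) (u := u) (v := 1 :: r)
    (by simpa using ht)
  obtain ⟨cs, ys, rfl, hcs, rfl⟩ := forestWord_eq_cons_iff.1 hvs
  obtain ⟨g, rfl⟩ := List.length_eq_one_iff.1 hcs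
  exact ⟨u, g, ys, ht, by simpa using hr⟩

theorem exists_word_eq_append_leaf {t g : OrderedTree} {u : List ℕ} {ys : List OrderedTree}
    (h : t.word = u ++ 1 :: forestWord (g :: ys)) :
    ∃ t' : OrderedTree, t'.word = u ++ 0 :: forestWord ys := by
  obtain ⟨ts', hlen, hts'⟩ := exists_forestWord_eq_append_of_length_eq
    (ts := [t]) (u := u) (vs := node [g] :: ys) (vs' := node [] :: ys) rfl (by simpa using h)
  obtain ⟨t', rfl⟩ := List.length_eq_one_iff.1 hlen
  exact ⟨t', by simpa using hts'⟩

theorem leaves_eq_count (t : OrderedTree) : t.leaves = t.word.count 0 := by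
  simp only [leaves, word, List.count, List.countP_map, Function.comp_def, beq_eq_decide]

theorem generators_eq_count (t : OrderedTree) :
    t.generators = t.word.count 0 + t.word.count 1 := by
  rw [generators, word]
  induction t.vertices with
  | nil => rfl
  | cons v vs ih =>
    simp only [List.countP_cons, ih, List.map_cons, List.count_cons]
    grind

theorem noUnary_iff {t : OrderedTree} : t.NoUnary ↔ 1 ∉ t.word := by
  simp [NoUnary, word]

theorem noUnary_node {ts : List OrderedTree} :
    (node ts).NoUnary ↔ ts.length ≠ 1 ∧ ∀ t ∈ ts, t.NoUnary := by
  simp [noUnary_iff, forestWord, eq_comm]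

theorem count_zero_forestWord (ts : List OrderedTree) :
    (forestWord ts).count 0 = (ts.map leaves).sum := by
  induction ts with
  | nil => rfl
  | cons t ts ih => simp [ih, leaves_eq_count]

theorem leaves_node {ts : List OrderedTree} (h : ts ≠ []) :
    (node ts).leaves = (ts.map leaves).sum := by
  rw [leaves_eq_count, word_node, List.count_cons_of_ne (by simpa using h), count_zero_forestWord]

@[simp] theorem leaves_node_nil : (node []).leaves = 1 := by
  simp [leaves_eq_count]

theorem leaves_pos : ∀ t : OrderedTree, 0 < t.leaves
  | node [] => by simp
  | node (t :: ts) => by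
    rw [leaves_node (List.cons_ne_nil t ts), List.map_cons, List.sum_cons]
    exact Nat.add_pos_left t.leaves_pos _

theorem sum_leaves_eq_zero_iff {ts : List OrderedTree} : (ts.map leaves).sum = 0 ↔ ts = [] := by
  obtain _ | ⟨t, ts⟩ := ts
  · simp
  · simp [t.leaves_pos.ne']

theorem length_graft_go (g : OrderedTree) (ts : List OrderedTree) (i : ℕ) :
    (graft.go g ts i).length = ts.length := by
  induction ts generalizing i with
  | nil => rfl
  | cons t ts ih => rw [graft.go]; split_ifs <;> simp [ih]

theorem forestWord_graft_go {g : OrderedTree} {ts : List OrderedTree}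
    (graft_mem : ∀ t ∈ ts, ∀ {u y : List ℕ}, t.word = u ++ 0 :: y →
      (graft g t (u.count 0)).word = u ++ 1 :: (g.word ++ y)) :
    ∀ {u y : List ℕ}, forestWord ts = u ++ 0 :: y →
      forestWord (graft.go g ts (u.count 0)) = u ++ 1 :: (g.word ++ y) := by
  induction ts with
  | nil => simp
  | cons t ts ih =>
    intro u y h
    rw [forestWord_cons] at h
    rw [graft.go]
    obtain ⟨z, ht, rfl⟩ | ⟨z, rfl, hts⟩ := append_eq_append_cons_cases h
    · rw [if_pos (by simp [leaves_eq_count, ht])]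
      simp [graft_mem t List.mem_cons_self ht]
    · rw [List.count_append, ← leaves_eq_count, if_neg (by simp), Nat.add_sub_cancel_left]
      simp [ih (fun s hs => graft_mem s (List.mem_cons_of_mem t hs)) hts]

theorem word_graft (g : OrderedTree) : ∀ (t : OrderedTree) {u y : List ℕ},
    t.word = u ++ 0 :: y → (graft g t (u.count 0)).word = u ++ 1 :: (g.word ++ y)
  | node [], u, y, h => by
    obtain ⟨rfl, rfl⟩ : u = [] ∧ y = [] := by obtain _ | ⟨k, u⟩ := u <;> simp_all
    simp [graft]
  | node (t :: ts), [], y, h => by simp at h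
  | node (t :: ts), k :: u, y, h => by
    rw [word_node, List.cons_append, List.cons.injEq] at h
    obtain ⟨rfl, h⟩ := h
    rw [List.count_cons_of_ne (by simp), graft, word_node, length_graft_go,
      forestWord_graft_go (fun s _ => word_graft g s) h, List.cons_append]

/-- `Insertion G L u rs` describes a state of the insertion algorithm started at `G`, after the
trees in `L` have been attached, each listed with the length of the descent preceding it: the tree
built so far has the word `u ++ forestWord rs`, where `u` lists the outdegrees of the vertices
before the root of the last attached tree. -/
inductive Insertion (G : OrderedTree) :
    List (ℕ × OrderedTree) → List ℕ → List OrderedTree → Prop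
  | init (hG : G.NoUnary) : Insertion G [] [] [G]
  | step {L : List (ℕ × OrderedTree)} {u x : List ℕ} {rs ys : List OrderedTree}
      {g : OrderedTree} (h : Insertion G L u rs) (hrs : forestWord rs = x ++ 0 :: forestWord ys)
      (hg : g.NoUnary) : Insertion G (L ++ [(x.count 0 + 1, g)]) (u ++ x ++ [1]) (g :: ys)

namespace Insertion

variable {G G' : OrderedTree} {L L' : List (ℕ × OrderedTree)} {u u' : List ℕ}
  {rs rs' : List OrderedTree}

theorem exists_foldl_eq (h : Insertion G L u rs) :
    ∃ t : OrderedTree, t.word = u ++ forestWord rs ∧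
      L.foldl ColoredDyckPath.insertStep (G, 0) = (t, u.count 0) := by
  induction h with
  | init => exact ⟨G, by simp, rfl⟩
  | @step L u x rs ys g _ hrs _ ih =>
    obtain ⟨t, ht, hfold⟩ := ih
    have hword : t.word = (u ++ x) ++ 0 :: forestWord ys := by rw [ht, hrs, List.append_assoc]
    refine ⟨graft g t ((u ++ x).count 0), ?_, by simp [hfold, ColoredDyckPath.insertStep]⟩
    rw [word_graft g t hword, forestWord_cons, List.append_assoc _ [1], List.singleton_append]

theorem one_notMem (h : Insertion G L u rs) : 1 ∉ forestWord rs := by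
  induction h with
  | init hG => simpa using noUnary_iff.1 hG
  | step _ hrs hg ih =>
    have := noUnary_iff.1 hg
    simp_all

theorem eq_nil_of_suffix {z : List ℕ} (h : Insertion G L u rs) (hz : z <:+ u) (h1 : 1 ∉ z) :
    z = [] := by
  cases h with
  | init => exact List.suffix_nil.1 hz
  | step =>
    obtain rfl | ⟨z, rfl, -⟩ := List.suffix_concat_iff.1 hz
    · rfl
    · simp at h1

theorem exists_eq_append {v w : List ℕ} (h : Insertion G L u rs)
    (heq : u ++ forestWord rs = v ++ w) (hw : 1 ∉ w) :
    ∃ x, v = u ++ x ∧ forestWord rs = x ++ w := by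
  obtain hx | ⟨z, hu, rfl⟩ := List.append_eq_append_iff.1 heq
  · exact hx
  · obtain rfl := h.eq_nil_of_suffix ⟨v, hu.symm⟩ fun hz => hw (List.mem_append_left _ hz)
    exact ⟨[], by simpa using hu.symm, by simp⟩

theorem count_zero_pos (h : Insertion G L u rs) : 0 < (forestWord rs).count 0 := by
  rw [count_zero_forestWord, Nat.pos_iff_ne_zero, Ne, sum_leaves_eq_zero_iff]
  cases h <;> exact List.cons_ne_nil _ _

theorem noUnary_left (h : Insertion G L u rs) : G.NoUnary := by
  induction h with
  | init hG => exact hG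
  | step _ _ _ ih => exact ih

theorem noUnary_of_mem (h : Insertion G L u rs) : ∀ x ∈ L, x.2.NoUnary := by
  induction h with
  | init => simp
  | step _ _ hg ih => simpa [or_imp, forall_and, hg] using ih

theorem one_le_of_mem (h : Insertion G L u rs) : ∀ x ∈ L, 1 ≤ x.1 := by
  induction h with
  | init => simp
  | step _ _ _ ih => simpa [or_imp, forall_and] using ih

theorem unique (h : Insertion G L u rs) (h' : Insertion G' L' u' rs')
    (heq : u ++ forestWord rs = u' ++ forestWord rs') :
    G = G' ∧ L = L' ∧ u = u' ∧ rs = rs' := by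
  induction h generalizing L' u' rs' with
  | init hG =>
    cases h' with
    | init => simpa using forestWord_injective heq
    | step =>
      have h1 : 1 ∈ [] ++ forestWord [G] := by rw [heq]; simp
      exact absurd (by simpa using h1) (noUnary_iff.1 hG)
  | @step L u x rs ys g h hrs hg ih =>
    cases h' with
    | init hG' =>
      have h1 : 1 ∈ [] ++ forestWord [G'] := by rw [← heq]; simp
      exact absurd (by simpa using h1) (noUnary_iff.1 hG')
    | @step L' u' x' rs' ys' g' h' hrs' hg' =>
      have heq : (u ++ x) ++ 1 :: forestWord (g :: ys) =
          (u' ++ x') ++ 1 :: forestWord (g' :: ys') := by simpa using heq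
      obtain ⟨hx, hys⟩ := append_cons_inj_of_notMem_right
        (h.step hrs hg).one_notMem (h'.step hrs' hg').one_notMem heq
      obtain ⟨rfl, rfl⟩ := List.cons.inj (forestWord_injective hys)
      obtain ⟨rfl, rfl, rfl, rfl⟩ := ih h' <| by
        rw [hrs, hrs', ← List.append_assoc, hx, List.append_assoc]
      obtain rfl := List.append_cancel_left hx
      exact ⟨rfl, rfl, rfl, rfl⟩

theorem exists_of_tree (t : OrderedTree) :
    ∃ G L u rs, Insertion G L u rs ∧ t.word = u ++ forestWord rs := by
  induction hk : t.word.count 1 generalizing t with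
  | zero => exact ⟨t, [], [], [t], .init (noUnary_iff.2 (List.count_eq_zero.1 hk)), by simp⟩
  | succ k ih =>
    have ht : 1 ∈ t.word := List.count_pos_iff.1 (by omega)
    -- The last vertex of outdegree 1 is the one below which the last tree was attached.
    obtain ⟨v, g, ys, hv, hg, hys⟩ := exists_word_eq_append_last_unary ht
    obtain ⟨t', ht'⟩ := exists_word_eq_append_leaf hv
    have hk' : t'.word.count 1 = k := by
      simpa [hv, ht', List.count_eq_zero.2 hg, List.count_eq_zero.2 hys] using hk
    obtain ⟨G, L, u, rs, h, hword⟩ := ih t' hk'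
    obtain ⟨x, rfl, hrs⟩ := h.exists_eq_append (hword.symm.trans ht') (by simpa using hys)
    exact ⟨G, _, _, _, h.step hrs (noUnary_iff.2 hg), by simp [hv]⟩

end Insertion

/-- The ordered forests with `j` leaves in total and no vertex of outdegree 1. -/
def SchroderForest (j : ℕ) : Type :=
  {ts : List OrderedTree // (ts.map leaves).sum = j ∧ ∀ t ∈ ts, t.NoUnary}

namespace SchroderForest

instance : Unique (SchroderForest 0) where
  default := ⟨[], rfl, by simp⟩
  uniq ts := Subtype.ext (sum_leaves_eq_zero_iff.1 ts.2.1)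

/-- Puts a one-vertex tree in front of a forest. -/
def consLeaf {n : ℕ} (ts : SchroderForest n) : SchroderForest (n + 1) :=
  ⟨node [] :: ts.1, by simp [ts.2.1, add_comm], by simpa [noUnary_node] using ts.2.2⟩

/-- Hangs the first tree of the first forest and the trees of the second forest, in this order,
from a common new root, whose tree becomes the first one of the resulting forest. -/
def joinHead {n : ℕ} :
    (Σ i : Fin n, SchroderForest (i + 1) × SchroderForest (n - i)) → SchroderForest (n + 1)
  | ⟨i, ⟨[], h⟩, _⟩ => absurd h.1 (by simp)
  | ⟨i, ⟨c :: ts, hts⟩, ⟨cs, hcs⟩⟩ => by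
    refine ⟨node (c :: cs) :: ts, ?_, ?_⟩
    · simp only [leaves_node, List.map_cons, List.sum_cons, ne_eq, reduceCtorEq,
        not_false_eq_true] at hts ⊢
      omega
    · have : cs ≠ [] := by
        rintro rfl
        exact (Nat.sub_ne_zero_of_lt i.2) hcs.1.symm
      simp_all [noUnary_node]

theorem bijective_elim_consLeaf_joinHead (n : ℕ) :
    Function.Bijective (Sum.elim (consLeaf (n := n)) joinHead) := by
  constructor
  · refine Function.Injective.sumElim (fun ts ts' h => ?_) ?_ ?_
    · exact Subtype.ext (List.cons.inj (congrArg Subtype.val h)).2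
    · rintro ⟨⟨i, hi⟩, ⟨_ | ⟨c, ts⟩, hts⟩, ⟨cs, hcs⟩⟩ ⟨⟨i', hi'⟩,
        ⟨_ | ⟨c', ts'⟩, hts'⟩, ⟨cs', hcs'⟩⟩ h
      · simp at hts
      · simp at hts
      · simp at hts'
      obtain ⟨⟨rfl, rfl⟩, rfl⟩ : (c = c' ∧ cs = cs') ∧ ts = ts' := by
        simpa [joinHead] using congrArg Subtype.val h
      obtain rfl : i = i' := by
        have := hts.1.symm.trans hts'.1
        simpa using this
      rfl
    · rintro ts ⟨⟨i, hi⟩, ⟨_ | ⟨c, ts⟩, hts⟩, ⟨cs, hcs⟩⟩ h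
      · simp at hts
      · simpa [joinHead, consLeaf] using congrArg Subtype.val h
  · rintro ⟨_ | ⟨⟨_ | ⟨c, cs⟩⟩, ts⟩, hsum, hts⟩
    · simp at hsum
    · exact ⟨.inl ⟨ts, by simpa [add_comm] using hsum, by simp_all⟩, rfl⟩
    · have hts : (cs ≠ [] ∧ c.NoUnary ∧ ∀ t ∈ cs, t.NoUnary) ∧ ∀ t ∈ ts, t.NoUnary := by
        simpa [noUnary_node] using hts
      have := c.leaves_pos
      have := Nat.pos_of_ne_zero (mt sum_leaves_eq_zero_iff.1 hts.1.1)
      have hsum : c.leaves + (cs.map leaves).sum + (ts.map leaves).sum = n + 1 := by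
        simpa [leaves_node] using hsum
      exact ⟨.inr ⟨⟨c.leaves + (ts.map leaves).sum - 1, by omega⟩,
        ⟨c :: ts, by simp only [List.map_cons, List.sum_cons]; omega, by simp_all⟩,
        ⟨cs, by dsimp only; omega, by simp_all⟩⟩, rfl⟩

instance (n : ℕ) : Finite (SchroderForest n) := by
  induction n using Nat.strong_induction_on with
  | _ n ih =>
    obtain _ | n := n
    · infer_instance
    have := ih n n.lt_succ_self
    have (i : Fin n) := ih (i + 1) (by omega)
    have (i : Fin n) := ih (n - i) (by omega)
    exact .of_surjective _ (bijective_elim_consLeaf_joinHead n).surjective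

theorem card_succ (n : ℕ) : Nat.card (SchroderForest (n + 1)) = Nat.card (SchroderForest n) +
    ∑ i : Fin n, Nat.card (SchroderForest (i + 1)) * Nat.card (SchroderForest (n - i)) := by
  simp only [← Nat.card_congr (.ofBijective _ (bijective_elim_consLeaf_joinHead n)), Nat.card_sum,
    Nat.card_sigma, Nat.card_prod]

theorem card_eq_largeSchroder (n : ℕ) :
    Nat.card (SchroderForest (n + 1)) = Nat.largeSchroder n := by
  induction n using Nat.strong_induction_on with
  | _ n ih =>
    obtain _ | n := n
    · rw [card_succ]; simp
    rw [card_succ, Nat.largeSchroder, ih n n.lt_succ_self]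
    congr 1
    refine Finset.sum_congr rfl fun i _ => ?_
    rw [ih i i.2, Nat.succ_sub (Nat.le_of_lt_succ i.2), ih (n - i) (by omega)]

/-- Schröder trees are the forests of one tree. -/
noncomputable def equivSingleton (j : ℕ) :
    SchroderTree j ≃ {ts : SchroderForest j // ts.1.length = 1} := by
  refine .ofBijective (fun t => ⟨⟨[t.1], by simpa using t.2⟩, rfl⟩) ⟨fun t t' h => ?_, ?_⟩
  · exact Subtype.ext (List.singleton_injective (congrArg (·.1.1) h))
  · rintro ⟨⟨ts, hts⟩, hlen⟩
    obtain ⟨t, rfl⟩ := List.length_eq_one_iff.1 hlen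
    exact ⟨⟨t, by simpa using hts⟩, rfl⟩

theorem ne_nil {j : ℕ} (hj : j ≠ 0) (ts : SchroderForest j) : ts.1 ≠ [] :=
  mt sum_leaves_eq_zero_iff.2 (ts.2.1.trans_ne hj)

/-- A Schröder tree with at least two leaves is determined by the forest below its root. -/
noncomputable def equivBelowRoot {j : ℕ} (hj : 2 ≤ j) :
    SchroderTree j ≃ {ts : SchroderForest j // ts.1.length ≠ 1} := by
  refine (Equiv.ofBijective (fun ts => ⟨node ts.1.1,
    (leaves_node (ne_nil (by omega) ts.1)).trans ts.1.2.1, noUnary_node.2 ⟨ts.2, ts.1.2.2⟩⟩)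
    ⟨fun ts ts' h => ?_, ?_⟩).symm
  · exact Subtype.ext (Subtype.ext (node.inj (congrArg Subtype.val h)))
  · rintro ⟨⟨ts⟩, hsum, hts⟩
    have hne : ts ≠ [] := by
      rintro rfl
      rw [leaves_node_nil] at hsum
      omega
    rw [noUnary_node] at hts
    exact ⟨⟨⟨ts, (leaves_node hne).symm.trans hsum, hts.2⟩, hts.1⟩, rfl⟩

theorem length_eq_one (ts : SchroderForest 1) : ts.1.length = 1 := by
  obtain ⟨_ | ⟨t, _ | ⟨t', ts⟩⟩, hsum, hts⟩ := ts
  · simp at hsum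
  · rfl
  · have := t.leaves_pos
    have := t'.leaves_pos
    simp only [List.map_cons, List.sum_cons] at hsum
    omega

end SchroderForest

instance (j : ℕ) : Finite (SchroderTree j) :=
  .of_equiv _ (SchroderForest.equivSingleton j).symm

theorem card_schroderTree_one : Nat.card (SchroderTree 1) = 1 := by
  rw [Nat.card_congr (SchroderForest.equivSingleton 1),
    Nat.card_congr (Equiv.subtypeUnivEquiv SchroderForest.length_eq_one),
    SchroderForest.card_eq_largeSchroder, Nat.largeSchroder_zero]

theorem card_schroderForest_eq_two_mul {j : ℕ} (hj : 2 ≤ j) :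
    Nat.card (SchroderForest j) = 2 * Nat.card (SchroderTree j) := by
  rw [← Nat.card_congr (Equiv.sumCompl fun ts : SchroderForest j => ts.1.length = 1),
    Nat.card_sum, ← Nat.card_congr (SchroderForest.equivSingleton j),
    ← Nat.card_congr (SchroderForest.equivBelowRoot hj), two_mul]

theorem card_schroderTree (j : ℕ) : Nat.card (SchroderTree (j + 1)) = littleSchroder j := by
  obtain _ | j := j
  · simp [card_schroderTree_one, littleSchroder]
  · have h := card_schroderForest_eq_two_mul (Nat.le_add_left 2 j)
    rw [SchroderForest.card_eq_largeSchroder,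
      ← Nat.two_mul_smallSchroder_succ j.succ_ne_zero] at h
    exact (Nat.eq_of_mul_eq_mul_left two_pos h).symm
end OrderedTree

namespace ColoredDyckPath

open DyckStep

/-- The lattice path consisting of `a` up-steps and, for each `x` in `L`, of `x.1` down-steps and
`x.2` up-steps. -/
def zigzag (a : ℕ) (L : List (ℕ × ℕ)) : List DyckStep :=
  List.replicate a U ++ L.flatMap fun x => List.replicate x.1 D ++ List.replicate x.2 U

@[simp] theorem zigzag_nil (a : ℕ) : zigzag a [] = List.replicate a U := by
  simp [zigzag]

theorem zigzag_cons (a : ℕ) (x : ℕ × ℕ) (L : List (ℕ × ℕ)) :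
    zigzag a (x :: L) = List.replicate a U ++ (List.replicate x.1 D ++ zigzag x.2 L) := by
  simp [zigzag]

theorem zigzag_concat (a : ℕ) (L : List (ℕ × ℕ)) (x : ℕ × ℕ) :
    zigzag a (L ++ [x]) = zigzag a L ++ List.replicate x.1 D ++ List.replicate x.2 U := by
  simp [zigzag]

theorem head?_zigzag_append {a : ℕ} (ha : 0 < a) (L : List (ℕ × ℕ)) (w : List DyckStep) :
    (zigzag a L ++ w).head? = some U := by
  simp [zigzag, List.head?_append, List.head?_replicate, ha.ne']

theorem splitBy_zigzag {b : ℕ} (hb : 0 < b) {L : List (ℕ × ℕ)} {a : ℕ} (ha : 0 < a)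
    (hL : ∀ x ∈ L, 0 < x.1 ∧ 0 < x.2) :
    (zigzag a L ++ List.replicate b D).splitBy (· == ·) = List.replicate a U ::
      (L.flatMap (fun x => [List.replicate x.1 D, List.replicate x.2 U]) ++
        [List.replicate b D]) := by
  induction L generalizing a with
  | nil =>
    rw [zigzag_nil, splitBy_replicate_append ha.ne' (by simp [List.head?_replicate, hb.ne']),
      List.splitBy_of_isChain (by simpa using hb.ne') (List.isChain_replicate_of_rel b (by simp))]
    rfl
  | cons x L ih =>
    obtain ⟨hx, hL⟩ := List.forall_mem_cons.1 hL
    rw [zigzag_cons, List.append_assoc, List.append_assoc,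
      splitBy_replicate_append ha.ne' (by simp [List.head?_append, List.head?_replicate, hx.1.ne']),
      splitBy_replicate_append hx.1.ne' (by simp [head?_zigzag_append hx.2]), ih hx.2 hL]
    rfl

theorem ascents_eq {p : DyckWord} {a b : ℕ} {L : List (ℕ × ℕ)} (ha : 0 < a) (hb : 0 < b)
    (hL : ∀ x ∈ L, 0 < x.1 ∧ 0 < x.2) (hp : p.toList = zigzag a L ++ List.replicate b D) :
    p.ascents = a :: L.map Prod.snd := by
  have hrun : ∀ x ∈ L, ([List.replicate x.1 D, List.replicate x.2 U].filter (U ∈ ·)).map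
      List.length = [x.2] := fun x hx => by simp [(hL x hx).2.ne']
  rw [DyckWord.ascents, DyckWord.runLengths, hp, splitBy_zigzag hb ha hL]
  rw [List.filter_cons_of_pos (by simpa using ha.ne'), List.filter_append, List.filter_flatMap,
    List.map_cons, List.map_append, List.map_flatMap, List.flatMap_congr hrun,
    ← List.map_eq_flatMap]
  simp

theorem descents_eq {p : DyckWord} {a b : ℕ} {L : List (ℕ × ℕ)} (ha : 0 < a) (hb : 0 < b)
    (hL : ∀ x ∈ L, 0 < x.1 ∧ 0 < x.2) (hp : p.toList = zigzag a L ++ List.replicate b D) :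
    p.descents = L.map Prod.fst ++ [b] := by
  have hrun : ∀ x ∈ L, ([List.replicate x.1 D, List.replicate x.2 U].filter (D ∈ ·)).map
      List.length = [x.1] := fun x hx => by simp [(hL x hx).1.ne']
  rw [DyckWord.descents, DyckWord.runLengths, hp, splitBy_zigzag hb ha hL]
  rw [List.filter_cons_of_neg (by simp), List.filter_append, List.filter_flatMap,
    List.map_append, List.map_flatMap, List.flatMap_congr hrun, ← List.map_eq_flatMap]
  simp [hb.ne']

theorem pos_of_mem_ascents {p : DyckWord} {a : ℕ} (h : a ∈ p.ascents) : 0 < a := by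
  obtain ⟨r, hr, rfl⟩ := List.mem_map.1 h
  exact List.length_pos_of_mem (of_decide_eq_true (List.mem_filter.1 hr).2)

theorem exists_cons_concat_eq_zigzag (w : List DyckStep) :
    ∃ a b L, (∀ x ∈ L, 0 < x.1 ∧ 0 < x.2) ∧
      U :: w ++ [D] = zigzag (a + 1) L ++ List.replicate (b + 1) D := by
  induction w with
  | nil => exact ⟨0, 0, [], by simp⟩
  | cons s w ih =>
    obtain ⟨a, b, L, hL, hw⟩ := ih
    have hw : w ++ [D] = zigzag a L ++ List.replicate (b + 1) D := by
      simpa [zigzag, List.replicate_succ] using hw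
    rw [List.cons_append, List.cons_append, hw]
    cases s with
    | U => exact ⟨a + 1, b, L, hL, by simp [zigzag, List.replicate_succ]⟩
    | D =>
      obtain _ | a := a
      · obtain _ | ⟨x, L⟩ := L
        · exact ⟨0, b + 1, [], by simp, by simp [List.replicate_succ]⟩
        · obtain ⟨hx, hL⟩ := List.forall_mem_cons.1 hL
          exact ⟨0, b, (x.1 + 1, x.2) :: L, by simpa [hx.2] using hL,
            by simp [zigzag_cons, List.replicate_succ]⟩
      · exact ⟨0, b, (1, a + 1) :: L, by simpa using hL, by simp [zigzag_cons]⟩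

theorem exists_toList_eq_zigzag {p : DyckWord} (hp : p ≠ 0) :
    ∃ a b L, 0 < a ∧ 0 < b ∧ (∀ x ∈ L, 0 < x.1 ∧ 0 < x.2) ∧
      p.toList = zigzag a L ++ List.replicate b D := by
  obtain ⟨a, b, L, hL, h⟩ := exists_cons_concat_eq_zigzag p.toList.dropLast.tail
  exact ⟨a + 1, b + 1, L, a.succ_pos, b.succ_pos, hL,
    (DyckWord.cons_tail_dropLast_concat hp).symm.trans h⟩

/-- Every prefix of the path has at least as many up-steps as down-steps. -/
def IsBallot (w : List DyckStep) : Prop := ∀ v, v <+: w → v.count D ≤ v.count U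

theorem isBallot_iff_take {w : List DyckStep} :
    IsBallot w ↔ ∀ i, (w.take i).count D ≤ (w.take i).count U := by
  refine ⟨fun h i => h _ (List.take_prefix i w), fun h v hv => ?_⟩
  rw [List.prefix_iff_eq_take.1 hv]
  exact h v.length

theorem isBallot_concat {w : List DyckStep} {s : DyckStep} :
    IsBallot (w ++ [s]) ↔ IsBallot w ∧ (w ++ [s]).count D ≤ (w ++ [s]).count U := by
  simp only [IsBallot, List.prefix_concat_iff, or_imp, forall_and, forall_eq, and_comm]

theorem isBallot_append_replicate_U {w : List DyckStep} {a : ℕ} :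
    IsBallot (w ++ List.replicate a U) ↔ IsBallot w := by
  induction a with
  | zero => simp
  | succ a ih =>
    rw [List.replicate_succ', ← List.append_assoc, isBallot_concat, ih, and_iff_left_iff_imp]
    intro h
    simpa [List.count_replicate] using Nat.le_add_right_of_le (h w List.prefix_rfl)

theorem isBallot_append_replicate_D {w : List DyckStep} {d : ℕ} :
    IsBallot (w ++ List.replicate d D) ↔ IsBallot w ∧ w.count D + d ≤ w.count U := by
  induction d with
  | zero => simpa using fun h => h w List.prefix_rfl
  | succ d ih =>
    have hD : (w ++ List.replicate d D ++ [D]).count D = w.count D + (d + 1) := by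
      simp
    have hU : (w ++ List.replicate d D ++ [D]).count U = w.count U := by
      simp [List.count_replicate]
    rw [List.replicate_succ', ← List.append_assoc, isBallot_concat, ih, and_assoc, hD, hU]
    exact and_congr_right fun _ => by omega

/-- The descent lengths in `L`, each paired with the length of the following ascent, which is
coloured by the accompanying tree. -/
def stepLengths (L : List (ℕ × OrderedTree)) : List (ℕ × ℕ) := L.map fun x => (x.1, x.2.leaves)

theorem zigzag_stepLengths_concat (a : ℕ) (L : List (ℕ × OrderedTree)) (x : ℕ × OrderedTree) :
    zigzag a (stepLengths (L ++ [x])) =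
      zigzag a (stepLengths L) ++ List.replicate x.1 D ++ List.replicate x.2.leaves U := by
  rw [stepLengths, List.map_append, List.map_singleton, zigzag_concat, ← stepLengths]

theorem count_U_zigzag_stepLengths_concat (a : ℕ) (L : List (ℕ × OrderedTree))
    (x : ℕ × OrderedTree) : (zigzag a (stepLengths (L ++ [x]))).count U =
      (zigzag a (stepLengths L)).count U + x.2.leaves := by
  simp [zigzag_stepLengths_concat, List.count_replicate]

theorem count_D_zigzag_stepLengths_concat (a : ℕ) (L : List (ℕ × OrderedTree))
    (x : ℕ × OrderedTree) : (zigzag a (stepLengths (L ++ [x]))).count D =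
      (zigzag a (stepLengths L)).count D + x.1 := by
  simp [zigzag_stepLengths_concat, List.count_replicate]

theorem pos_of_mem_stepLengths {L : List (ℕ × OrderedTree)} (hL : ∀ x ∈ L, 0 < x.1) :
    ∀ x ∈ stepLengths L, 0 < x.1 ∧ 0 < x.2 :=
  List.forall_mem_map.2 fun x hx => ⟨hL x hx, x.2.leaves_pos⟩

theorem exists_stepLengths_eq {Gs : List OrderedTree} {L : List (ℕ × ℕ)}
    (h : Gs.map OrderedTree.leaves = L.map Prod.snd) :
    ∃ L', stepLengths L' = L ∧ L'.map Prod.snd = Gs := by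
  induction Gs generalizing L with
  | nil => exact ⟨[], by simpa [stepLengths] using h⟩
  | cons g Gs ih =>
    obtain _ | ⟨x, L⟩ := L
    · simp at h
    obtain ⟨hg, h⟩ := List.cons.inj h
    obtain ⟨L', rfl, rfl⟩ := ih h
    exact ⟨(x.1, g) :: L', by simp [stepLengths, hg]⟩

end ColoredDyckPath

namespace OrderedTree.Insertion

open DyckStep ColoredDyckPath

variable {G : OrderedTree} {L : List (ℕ × OrderedTree)} {u : List ℕ} {rs : List OrderedTree}

theorem count_U_eq_count_D_add (h : Insertion G L u rs) :
    (zigzag G.leaves (stepLengths L)).count U =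
      (zigzag G.leaves (stepLengths L)).count D + (forestWord rs).count 0 := by
  induction h with
  | init => simp [stepLengths, leaves_eq_count, List.count_replicate]
  | @step L u x rs ys g _ hrs _ ih =>
    rw [hrs, List.count_append, List.count_cons_self] at ih
    rw [count_U_zigzag_stepLengths_concat, count_D_zigzag_stepLengths_concat, forestWord_cons,
      List.count_append, leaves_eq_count g]
    omega

theorem isBallot (h : Insertion G L u rs) : IsBallot (zigzag G.leaves (stepLengths L)) := by
  induction h with
  | init => simpa [stepLengths] using
      (isBallot_append_replicate_U (w := [])).2 (by simp [IsBallot])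
  | step h hrs _ ih =>
    rw [zigzag_stepLengths_concat, isBallot_append_replicate_U, isBallot_append_replicate_D]
    refine ⟨ih, ?_⟩
    rw [h.count_U_eq_count_D_add, hrs]
    simp

theorem count_U_eq (h : Insertion G L u rs) :
    (zigzag G.leaves (stepLengths L)).count U =
      (u ++ forestWord rs).count 0 + (u ++ forestWord rs).count 1 := by
  induction h with
  | init hG => simp [stepLengths, leaves_eq_count, List.count_eq_zero.2 (noUnary_iff.1 hG)]
  | @step L u x rs ys g _ hrs hg ih =>
    have hg1 := List.count_eq_zero.2 (noUnary_iff.1 hg)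
    have hzero : (u ++ x ++ [1] ++ forestWord (g :: ys)).count 0 + 1 =
        (u ++ forestWord rs).count 0 + g.leaves := by
      simp [hrs, leaves_eq_count, add_comm, add_left_comm, add_assoc]
    have hone : (u ++ x ++ [1] ++ forestWord (g :: ys)).count 1 =
        (u ++ forestWord rs).count 1 + 1 := by
      simp [hrs, hg1, add_assoc]
    rw [count_U_zigzag_stepLengths_concat, ih, hone, add_right_comm, ← hzero]
    ring

theorem exists_of_isBallot (hG : G.NoUnary) (hL : ∀ x ∈ L, 0 < x.1 ∧ x.2.NoUnary)
    (h : IsBallot (zigzag G.leaves (stepLengths L))) : ∃ u rs, Insertion G L u rs := by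
  induction L using List.reverseRecOn with
  | nil => exact ⟨[], [G], .init hG⟩
  | append_singleton L x ih =>
    obtain ⟨d, g⟩ := x
    simp only [List.forall_mem_append, List.forall_mem_singleton] at hL
    rw [zigzag_stepLengths_concat, isBallot_append_replicate_U, isBallot_append_replicate_D] at h
    obtain ⟨u, rs, hi⟩ := ih hL.1 h.1
    have hd : d - 1 < (forestWord rs).count 0 := by
      have := hi.count_U_eq_count_D_add
      omega
    obtain ⟨y, z, hrs, hy⟩ := exists_eq_append_cons_of_lt_count hd
    obtain ⟨ys, hys⟩ := exists_forestWord_eq_of_append (hrs.trans (List.append_cons y 0 z))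
    have hstep := hi.step (hys ▸ hrs) hL.2.2
    rw [hy, Nat.sub_add_cancel hL.2.1] at hstep
    exact ⟨_, _, hstep⟩

end OrderedTree.Insertion

namespace ColoredDyckPath

open DyckStep OrderedTree

variable {n : ℕ}

/-- The trees that colour the ascents of a path. -/
def colors (P : ColoredDyckPath SchroderTree n) : List OrderedTree :=
  List.ofFn fun i => (P.color i).1

theorem map_leaves_colors (P : ColoredDyckPath SchroderTree n) :
    P.colors.map leaves = P.path.ascents := by
  rw [colors, List.map_ofFn]
  exact (congrArg List.ofFn (funext fun i => (P.color i).2.1)).trans (List.ofFn_get _)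

theorem noUnary_of_mem_colors (P : ColoredDyckPath SchroderTree n) : ∀ g ∈ P.colors, g.NoUnary :=
  (List.forall_mem_ofFn_iff).2 fun i => (P.color i).2.2

theorem ext_colors {P Q : ColoredDyckPath SchroderTree n} (h : P.path = Q.path)
    (hc : P.colors = Q.colors) : P = Q := by
  obtain ⟨p, hp, c⟩ := P
  obtain ⟨q, hq, d⟩ := Q
  obtain rfl : p = q := h
  congr
  exact funext fun i => Subtype.ext (congrFun (List.ofFn_injective hc) i)

theorem exists_of_colors {p : DyckWord} (hp : p.semilength = n) {Gs : List OrderedTree}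
    (hleaves : Gs.map leaves = p.ascents) (hGs : ∀ g ∈ Gs, g.NoUnary) :
    ∃ P : ColoredDyckPath SchroderTree n, P.path = p ∧ P.colors = Gs := by
  have hlen : p.ascents.length = Gs.length := by rw [← hleaves, List.length_map]
  refine ⟨⟨p, hp, fun i => ⟨Gs.get (i.cast hlen), ?_, hGs _ (List.get_mem ..)⟩⟩, rfl, ?_⟩
  · simp [← hleaves]
  · exact List.ext_getElem (by simp [colors, hlen]) (by simp [colors])

/-- The path `P` starts with an ascent coloured by `G`, which is followed, for each `(d, g)` in
`L`, by a descent of length `d` and an ascent coloured by `g`, and ends with a descent of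
length `b`. -/
structure HasShape (P : ColoredDyckPath SchroderTree n) (G : OrderedTree)
    (L : List (ℕ × OrderedTree)) (b : ℕ) : Prop where
  descent_pos : ∀ x ∈ L, 0 < x.1
  last_pos : 0 < b
  toList_eq : P.path.toList = zigzag G.leaves (stepLengths L) ++ List.replicate b D
  colors_eq : P.colors = G :: L.map Prod.snd

theorem exists_hasShape (hn : n ≠ 0) (P : ColoredDyckPath SchroderTree n) :
    ∃ G L b, P.HasShape G L b := by
  have hP : P.path ≠ 0 := by
    intro h
    exact hn (by rw [← P.semilength_eq, h, DyckWord.semilength_zero])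
  obtain ⟨a, b, L, ha, hb, hL, htoList⟩ := exists_toList_eq_zigzag hP
  have hleaves := P.map_leaves_colors.trans (ascents_eq ha hb hL htoList)
  obtain ⟨G, Gs, hcolors, rfl, hGs⟩ := List.map_eq_cons_iff.1 hleaves
  obtain ⟨L, rfl, rfl⟩ := exists_stepLengths_eq hGs
  exact ⟨G, L, b, fun x hx => (hL _ (List.mem_map_of_mem hx)).1, hb, htoList, hcolors⟩

namespace HasShape

variable {P Q : ColoredDyckPath SchroderTree n} {G : OrderedTree} {L : List (ℕ × OrderedTree)}
  {b b' : ℕ}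

theorem toTree_eq (h : P.HasShape G L b) : P.toTree = (L.foldl insertStep (G, 0)).1 := by
  have hdescents := descents_eq G.leaves_pos h.last_pos
    (pos_of_mem_stepLengths h.descent_pos) h.toList_eq
  have hzip : P.path.descents.zip (L.map Prod.snd) = L := by
    rw [hdescents, stepLengths, List.map_map, ← List.append_nil (L.map Prod.snd),
      List.zip_append (by simp), List.zip_map']
    simp
  rw [toTree, ← colors, h.colors_eq, insertAll, hzip]

theorem noUnary (h : P.HasShape G L b) : G.NoUnary ∧ ∀ x ∈ L, x.2.NoUnary := by
  have hcolors := P.noUnary_of_mem_colors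
  rwa [h.colors_eq, List.forall_mem_cons, List.forall_mem_map] at hcolors

theorem exists_insertion (h : P.HasShape G L b) :
    ∃ u rs, Insertion G L u rs ∧ P.toTree.word = u ++ forestWord rs := by
  have hballot : IsBallot P.path.toList := isBallot_iff_take.2 P.path.count_D_le_count_U
  rw [h.toList_eq, isBallot_append_replicate_D] at hballot
  obtain ⟨u, rs, hi⟩ := Insertion.exists_of_isBallot h.noUnary.1
    (fun x hx => ⟨h.descent_pos x hx, h.noUnary.2 x hx⟩) hballot.1
  obtain ⟨t, ht, hfold⟩ := hi.exists_foldl_eq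
  exact ⟨u, rs, hi, by rw [h.toTree_eq, hfold, ht]⟩

theorem count_U_eq (h : P.HasShape G L b) : (zigzag G.leaves (stepLengths L)).count U = n := by
  rw [← P.semilength_eq, DyckWord.semilength, h.toList_eq]
  simp [List.count_replicate]

theorem generators_toTree (h : P.HasShape G L b) : P.toTree.generators = n := by
  obtain ⟨u, rs, hi, hword⟩ := h.exists_insertion
  rw [generators_eq_count, hword, ← hi.count_U_eq, h.count_U_eq]

theorem count_U_eq_add (h : P.HasShape G L b) : (zigzag G.leaves (stepLengths L)).count U =
    (zigzag G.leaves (stepLengths L)).count D + b := by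
  simpa [h.toList_eq, List.count_replicate] using P.path.count_U_eq_count_D

theorem unique (h : P.HasShape G L b) (h' : Q.HasShape G L b') : P = Q := by
  obtain rfl : b = b' := Nat.add_left_cancel (h.count_U_eq_add.symm.trans h'.count_U_eq_add)
  exact ext_colors (DyckWord.ext (h.toList_eq.trans h'.toList_eq.symm))
    (h.colors_eq.trans h'.colors_eq.symm)

end HasShape

theorem exists_hasShape_of_insertion {G : OrderedTree} {L : List (ℕ × OrderedTree)} {u : List ℕ}
    {rs : List OrderedTree} (h : Insertion G L u rs) :
    ∃ P : ColoredDyckPath SchroderTree ((zigzag G.leaves (stepLengths L)).count U),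
      ∃ b, P.HasShape G L b := by
  let b := (forestWord rs).count 0
  let p : DyckWord := ⟨zigzag G.leaves (stepLengths L) ++ List.replicate b D,
    by simpa [List.count_replicate] using h.count_U_eq_count_D_add,
    isBallot_iff_take.1 (isBallot_append_replicate_D.2 ⟨h.isBallot, h.count_U_eq_count_D_add.ge⟩)⟩
  have hascents : p.ascents = G.leaves :: (stepLengths L).map Prod.snd :=
    ascents_eq G.leaves_pos h.count_zero_pos (pos_of_mem_stepLengths h.one_le_of_mem) rfl
  obtain ⟨P, hpath, hcolors⟩ := exists_of_colors (p := p) (Gs := G :: L.map Prod.snd)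
    (n := (zigzag G.leaves (stepLengths L)).count U)
    (by simp [p, DyckWord.semilength, List.count_replicate]) (by simp [hascents, stepLengths])
    (by simpa using ⟨h.noUnary_left, fun g d hg => h.noUnary_of_mem (d, g) hg⟩)
  exact ⟨P, b, h.one_le_of_mem, h.count_zero_pos, by rw [hpath], hcolors⟩

theorem injective_toTree (hn : n ≠ 0) : Function.Injective (toTree (n := n)) := by
  intro P Q hPQ
  obtain ⟨G, L, b, hP⟩ := P.exists_hasShape hn
  obtain ⟨G', L', b', hQ⟩ := Q.exists_hasShape hn
  obtain ⟨u, rs, hi, hword⟩ := hP.exists_insertion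
  obtain ⟨u', rs', hi', hword'⟩ := hQ.exists_insertion
  obtain ⟨rfl, rfl, -, -⟩ := hi.unique hi' (by rw [← hword, ← hword', hPQ])
  exact hP.unique hQ

theorem exists_toTree_eq (t : OrderedTree) :
    ∃ P : ColoredDyckPath SchroderTree t.generators, P.toTree = t := by
  obtain ⟨G, L, u, rs, h, hword⟩ := Insertion.exists_of_tree t
  obtain ⟨P, b, hP⟩ := exists_hasShape_of_insertion h
  obtain ⟨t', ht', hfold⟩ := h.exists_foldl_eq
  rw [generators_eq_count, hword, ← h.count_U_eq]
  exact ⟨P, by rw [hP.toTree_eq, hfold, word_injective (ht'.trans hword.symm)]⟩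

theorem bijOn_toTree (hn : n ≠ 0) :
    Set.BijOn (toTree (n := n)) Set.univ {t : OrderedTree | t.generators = n} := by
  refine ⟨fun P _ => ?_, (injective_toTree hn).injOn, ?_⟩
  · obtain ⟨G, L, b, hP⟩ := P.exists_hasShape hn
    exact hP.generators_toTree
  · rintro t rfl
    simpa using exists_toTree_eq t

/-- Recolouring along a family of bijections between the sets of colours. -/
def congrColor {C C' : ℕ → Type} (e : ∀ j, 1 ≤ j → C j ≃ C' j) :
    ColoredDyckPath C n ≃ ColoredDyckPath C' n where
  toFun P := ⟨P.path, P.semilength_eq,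
    fun i => e _ (pos_of_mem_ascents (List.get_mem ..)) (P.color i)⟩
  invFun P := ⟨P.path, P.semilength_eq,
    fun i => (e _ (pos_of_mem_ascents (List.get_mem ..))).symm (P.color i)⟩
  left_inv P := by simp
  right_inv P := by simp

end ColoredDyckPath

theorem mainTheorem3 (n : ℕ) (hn : 1 ≤ n) :
    (∀ j : ℕ, 1 ≤ j → Nat.card (SchroderTree j) = littleSchroder (j - 1)) ∧
    Set.BijOn (ColoredDyckPath.toTree (n := n)) Set.univ {t : OrderedTree | t.generators = n} ∧
    Nonempty (ColoredDyckPath (fun j => Fin (littleSchroder (j - 1))) n ≃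
      {t : OrderedTree // t.generators = n}) := by
  have card_eq (j : ℕ) (hj : 1 ≤ j) : Nat.card (SchroderTree j) = littleSchroder (j - 1) := by
    simpa [Nat.sub_add_cancel hj] using OrderedTree.card_schroderTree (j - 1)
  have bijOn := ColoredDyckPath.bijOn_toTree (Nat.one_le_iff_ne_zero.1 hn)
  have recolor : ColoredDyckPath (fun j => Fin (littleSchroder (j - 1))) n ≃
      ColoredDyckPath SchroderTree n :=
    ColoredDyckPath.congrColor fun j hj => (Finite.equivFinOfCardEq (card_eq j hj)).symm
  exact ⟨card_eq, bijOn, ⟨recolor.trans <| (Equiv.Set.univ _).symm.trans (bijOn.equiv _)⟩⟩
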